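/- Let $\omega\in\mathbb R$, and for $\varepsilon\in\mathbb R$ consider the stationary discrete nonlinear Schrödinger equation with nearest-neighbour and next-to-next-nearest-neighbour coupling $$\omega\phi_j=-\frac{\varepsilon}{2}\bigl[(\Delta_1+\Delta_3)\phi\bigr]_j+\frac34\,\phi_j|\phi_j|^2,\qquad (\Delta_l\phi)_j:=\phi_{j+l}-2\phi_j+\phi_{j-l},\qquad j\in\mathbb Z,$$ for $\phi=(\phi_j)_{j\in\mathbb Z}\in\ell^2(\mathbb Z;\mathbb C)$. Let $R>0$ and $\theta_1,\theta_2,\theta_3,\theta_4\in\mathbb R$, and let $\phi^{(0)}$ be the four-site configuration with $\phi^{(0)}_j=Re^{i\theta_j}$ for $j\in\{1,2,3,4\}$ and $\phi^{(0)}_j=0$ for every other $j\in\mathbb Z$. Say that $\phi^{(0)}$ can be continued at fixed frequency $\omega$ if there are a set $E\subset\mathbb R$ that contains $0$ and nonzero numbers arbitrarily close to $0$ (for instance $E=(-\varepsilon_0,\varepsilon_0)$, $[0,\varepsilon_0)$ or $(-\varepsilon_0,0]$ with $\varepsilon_0>0$), and a map $\varepsilon\mapsto\phi(\varepsilon)\in\ell^2(\mathbb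 Z;\mathbb C)$ on $E$ with $\phi(0)=\phi^{(0)}$, continuous at $\varepsilon=0$ in the norm of $\ell^2$, such that $\phi(\varepsilon)$ solves the equation with parameters $\omega$ and $\varepsilon$ for every $\varepsilon\in E$ (in particular, for $\varepsilon=0$, $\omega=\frac34R^2$). No further regularity in $\varepsilon$ is required. If $\phi^{(0)}$ can be continued at fixed frequency $\omega$, then each of the phase shifts $\varphi_j:=\theta_{j+1}-\theta_j$, $j=1,2,3$, is equal to $0$ or $\pi$ modulo $2\pi$. In particular no asymmetric vortex, with $(\varphi_1,\varphi_2,\varphi_3)$ equal to $(\varphi,\pi-\varphi,\pi-\varphi)$, $(\varphi,\varphi,\pi-\varphi)$ or $(\varphi,\pi-\varphi,\varphi)$ modulo $2\pi$ and $\varphi\notin\pi\mathbb Z$, and neither of the symmetric vortices $\pm\left(\frac\pi2,\frac\pi2,\frac\pi2\right)$, can be continued. -/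

import Mathlib

open scoped Topology

/-- The complex sequence space `ℓ²(ℤ; ℂ)` with its Hilbert space norm. -/
abbrev EllTwo : Type := lp (fun _ : ℤ => ℂ) 2

/-- The discrete operator `(Δ_l φ)_j = φ_{j+l} - 2 φ_j + φ_{j-l}`. -/
def latticeLaplacian (l : ℤ) (φ : ℤ → ℂ) (j : ℤ) : ℂ :=
  φ (j + l) - 2 * φ j + φ (j - l)

/-- The stationary dNLS equation with nearest-neighbour and next-to-next-nearest-neighbour
coupling `ε`, at frequency `ω`:
`ω φ_j = -(ε/2) [(Δ₁ + Δ₃) φ]_j + (3/4) φ_j |φ_j|²` at every site `j`. -/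
def IsStationarySolution (ω ε : ℝ) (φ : EllTwo) : Prop :=
  ∀ j : ℤ, (ω : ℂ) * φ j =
    -((ε : ℂ) / 2) * (latticeLaplacian 1 φ j + latticeLaplacian 3 φ j)
      + (3 / 4 : ℂ) * φ j * ((‖φ j‖ ^ 2 : ℝ) : ℂ)

/-- The four-site configuration `R e^{i θ_j}` for `j ∈ S = {1,2,3,4}`, and `0` elsewhere. -/
noncomputable def fourSiteConfig (R : ℝ) (θ : ℤ → ℝ) (j : ℤ) : ℂ :=
  if j ∈ Finset.Icc (1 : ℤ) 4 then (R : ℂ) * Complex.exp (Complex.I * (θ j : ℂ)) else 0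

/-- `φ`, as a function of `ε` in the parameter set `E`, is a continuation of the configuration
`v` at the fixed frequency `ω`: the set `E` contains `0` and nonzero values of `ε` arbitrarily
close to `0` (for instance `E = (-ε₀, ε₀)`, `[0, ε₀)` or `(-ε₀, 0]`), the map `φ` starts from
`v`, is continuous at `ε = 0` along `E` in the norm of `ℓ²`, and `φ ε` solves the stationary
equation for every `ε ∈ E`. Nothing is asked of `φ` outside `E`. -/
structure IsContinuation (ω : ℝ) (v : ℤ → ℂ) (E : Set ℝ) (φ : ℝ → EllTwo) : Prop where
  zero_mem : (0 : ℝ) ∈ E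
  accumulates : ∀ δ > 0, ∃ ε ∈ E, ε ≠ 0 ∧ |ε| < δ
  continuous_at_zero : ContinuousWithinAt φ E 0
  start : ∀ j : ℤ, φ 0 j = v j
  solves : ∀ ε ∈ E, IsStationarySolution ω ε (φ ε)

/-- The configuration `v` can be continued, at fixed frequency `ω`, to solutions with `ε ≠ 0`. -/
def CanBeContinued (ω : ℝ) (v : ℤ → ℂ) : Prop :=
  ∃ (E : Set ℝ) (φ : ℝ → EllTwo), IsContinuation ω v E φ

/-- The phase shift `θ_{j+1} - θ_j` between successive sites, modulo `2π`. -/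
noncomputable def phaseShift (θ : ℤ → ℝ) (j : ℤ) : Real.Angle :=
  ((θ (j + 1) - θ j : ℝ) : Real.Angle)

/-!
# Rigidity of the phases of continued four-site configurations

Write `z₁, …, z₄` for the values of a solution on the four central sites. At `ε ≠ 0` the equation
at every site reads `neighbourSum φ j + m_j φ_j = 0`, where
`m_j = (2/ε) (ω - 2ε - (3/4) ‖φ_j‖²)` is *real*, so the sequence and its complex conjugate solve
the same real linear system. Taking imaginary parts after multiplication by `star (φ_j)` and letting
`ε → 0` at the sites `2` and `3` shows that the three phase shifts have the same sine
(`IsContinuation.sin_phase_eq`). If that sine is nonzero, the pairs `(z₁, star z₁)` and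
`(z₂, star z₂)` are uniformly linearly independent along the continuation, and the rest of the
argument is a contradiction at second order in the small parameter `κ = ε / (2 (ω - 2ε))`.

Outside the four sites `φ_k = O(κ)` and `φ_k = -κ neighbourSum φ k + O(κ³)`. Eliminating these sites
leaves four equations modulo `κ³` (`reduced_equations`) in terms of the detunings `e_j = m_j - κ`:
a ring `1 — 2 — 3 — 4 — 1` in which the three bonds `1–2`, `2–3`, `3–4` carry a correction `2κ²`,
caused by paths of length three through the outer sites, and the bond `4–1` carries none. Since two
linearly independent vectors solve this real system, all its `3 × 3` minors vanish modulo `κ³`; the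
asymmetry of the ring then shows up as `e₁ e₂ = 2κ² + O(κ³)`. The amplitudes satisfy
`‖z_j‖² = N - κ N e_j + O(κ³)` with one `N` for the four sites, and inserting `z₃`, `z₄` as
combinations of `z₁`, `z₂` gives two more relations (`truncated_relations`). Together they imply
`2κ² N (e₁ + e₂) = O(κ³) (|e₁| + |e₂|) + O(κ⁴)`. But `e₁ e₂ ≈ 2κ² > 0` forces
`|e₁ + e₂| = |e₁| + |e₂| ≥ 2|κ|`, so `N = O(κ)`, whereas `N → (4/3) ω > 0`. No size is assumed for
`e₁` and `e₂`, so the asymmetric families and the fully degenerate symmetric vortices, where all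
detunings tend to zero, are covered at once.

The symbol `O(κ³)` is made algebraic: along a sequence of parameters, all quantities are elements
of the ring of bounded sequences, `O(κ³)` means divisibility by `κ³` there, and the computations
take place in the quotient ring, in which `κ³ = 0`.
-/

open Filter

/-! ### Algebra of the four-site ring modulo the cube of the coupling -/

theorem coeff_eq_zero {Q : Type*} [CommRing Q] {z₁ z₂ w₁ w₂ a b : Q}
    (hD : IsUnit (z₁ * w₂ - w₁ * z₂)) (hz : a * z₁ + b * z₂ = 0) (hw : a * w₁ + b * w₂ = 0) :
    a = 0 ∧ b = 0 := by
  constructor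
  · exact (hD.mul_left_eq_zero).1 (by linear_combination w₂ * hz - z₂ * hw)
  · exact (hD.mul_left_eq_zero).1 (by linear_combination z₁ * hw - w₁ * hz)

/-- The equations at the sites `1` and `2`, solved for `z₃` and `z₄`. -/
theorem ring_solve_three_four {Q : Type*} [CommRing Q] {κ e₁ e₂ z₁ z₂ z₃ z₄ : Q}
    (hκ : κ ^ 3 = 0)
    (h₁ : e₁ * z₁ - κ * (z₁ + z₃) + (z₂ + z₄) + 2 * κ ^ 2 * z₂ = 0)
    (h₂ : e₂ * z₂ - κ * (z₂ + z₄) + (1 + 2 * κ ^ 2) * (z₁ + z₃) = 0) :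
    z₃ = -((1 + κ * e₁) * z₁ + (1 - κ ^ 2) * e₂ * z₂) ∧
    z₄ = -((1 + κ * e₂ + 2 * κ ^ 2) * z₂ + (1 + κ ^ 2) * e₁ * z₁) := by
  have hA : (z₁ + z₃) + κ * e₁ * z₁ + (1 - κ ^ 2) * e₂ * z₂ = 0 := by
    linear_combination (1 + κ ^ 2) * ((1 - 2 * κ ^ 2) * h₂ + κ * h₁)
      - (-κ * (z₁ + z₃) + e₁ * z₁ - 2 * κ * e₂ * z₂
        + (1 + κ ^ 2) * (2 * (z₂ + z₄) - 4 * κ * (z₁ + z₃) + 2 * z₂)) * hκ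
  exact ⟨by linear_combination hA, by linear_combination h₁ + κ * hA + e₂ * z₂ * hκ⟩

/-- The equations at the sites `3` and `4` as linear relations between `z₁` and `z₂`. When `z₁` and
`z₂` are independent, their coefficients vanish, which is the rank condition on the ring. -/
theorem ring_rank_relations {Q : Type*} [CommRing Q] {κ e₁ e₂ e₃ e₄ z₁ z₂ z₃ z₄ : Q}
    (hκ : κ ^ 3 = 0)
    (h₁ : e₁ * z₁ - κ * (z₁ + z₃) + (z₂ + z₄) + 2 * κ ^ 2 * z₂ = 0)
    (h₂ : e₂ * z₂ - κ * (z₂ + z₄) + (1 + 2 * κ ^ 2) * (z₁ + z₃) = 0)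
    (h₃ : e₃ * z₃ - κ * (z₁ + z₃) + (1 + 2 * κ ^ 2) * (z₂ + z₄) = 0)
    (h₄ : e₄ * z₄ - κ * (z₂ + z₄) + (z₁ + z₃) + 2 * κ ^ 2 * z₃ = 0) :
    (e₃ * (1 + κ * e₁) + e₁ + 2 * κ ^ 2 * e₁) * z₁ + (e₃ * e₂ * (1 - κ ^ 2) + 2 * κ ^ 2) * z₂ = 0 ∧
    (e₄ * (1 + κ ^ 2) * e₁ + 2 * κ ^ 2) * z₁ +
      (e₄ * (1 + κ * e₂ + 2 * κ ^ 2) + e₂) * z₂ = 0 := by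
  obtain ⟨h5, h6⟩ := ring_solve_three_four hκ h₁ h₂
  constructor
  · have : e₃ * z₃ = e₁ * z₁ - 2 * κ ^ 2 * z₄ := by linear_combination h₃ - h₁
    linear_combination e₃ * h5 - this + 2 * κ ^ 2 * h6
      + (-2 * e₂ * z₂ - 4 * κ * z₂ - 2 * κ * e₁ * z₁) * hκ
  · have : e₄ * z₄ = e₂ * z₂ - 2 * κ ^ 2 * z₃ + 2 * κ ^ 2 * (z₁ + z₃) := by
      linear_combination h₄ - h₂
    linear_combination e₄ * h6 - this

/-- The rank condition and the amplitude conditions at the sites `3` and `4`, modulo `κ³`, with `w_j`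
in the role of the complex conjugate of `z_j`. -/
theorem truncated_relations {Q : Type*} [CommRing Q]
    {κ N e₁ e₂ e₃ e₄ z₁ z₂ z₃ z₄ w₁ w₂ w₃ w₄ : Q}
    (hκ : κ ^ 3 = 0) (hD : IsUnit (z₁ * w₂ - w₁ * z₂))
    (h₁ : e₁ * z₁ - κ * (z₁ + z₃) + (z₂ + z₄) + 2 * κ ^ 2 * z₂ = 0)
    (h₂ : e₂ * z₂ - κ * (z₂ + z₄) + (1 + 2 * κ ^ 2) * (z₁ + z₃) = 0)
    (h₃ : e₃ * z₃ - κ * (z₁ + z₃) + (1 + 2 * κ ^ 2) * (z₂ + z₄) = 0)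
    (h₄ : e₄ * z₄ - κ * (z₂ + z₄) + (z₁ + z₃) + 2 * κ ^ 2 * z₃ = 0)
    (k₁ : e₁ * w₁ - κ * (w₁ + w₃) + (w₂ + w₄) + 2 * κ ^ 2 * w₂ = 0)
    (k₂ : e₂ * w₂ - κ * (w₂ + w₄) + (1 + 2 * κ ^ 2) * (w₁ + w₃) = 0)
    (k₃ : e₃ * w₃ - κ * (w₁ + w₃) + (1 + 2 * κ ^ 2) * (w₂ + w₄) = 0)
    (k₄ : e₄ * w₄ - κ * (w₂ + w₄) + (w₁ + w₃) + 2 * κ ^ 2 * w₃ = 0)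
    (n₁ : z₁ * w₁ = N - κ * N * e₁) (n₂ : z₂ * w₂ = N - κ * N * e₂)
    (n₃ : z₃ * w₃ = N - κ * N * e₃) (n₄ : z₄ * w₄ = N - κ * N * e₄) :
    e₁ * e₂ - 2 * κ ^ 2 = 0 ∧
    (1 - κ ^ 2) * e₂ * (z₁ * w₂ + w₁ * z₂) + (1 - 2 * κ ^ 2) * e₂ ^ 2 * N * (1 - κ * e₂) = 0 ∧
    4 * κ ^ 2 * N + (1 + 3 * κ ^ 2) * e₁ * (z₁ * w₂ + w₁ * z₂)
      + (1 + 2 * κ ^ 2) * e₁ ^ 2 * N * (1 - κ * e₁) = 0 := by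
  obtain ⟨hz₃, hz₄⟩ := ring_solve_three_four hκ h₁ h₂
  obtain ⟨hw₃, hw₄⟩ := ring_solve_three_four hκ k₁ k₂
  obtain ⟨a, b⟩ := ring_rank_relations hκ h₁ h₂ h₃ h₄
  obtain ⟨a', b'⟩ := ring_rank_relations hκ k₁ k₂ k₃ k₄
  obtain ⟨r₁, r₂⟩ := coeff_eq_zero hD a a'
  obtain ⟨r₃, r₄⟩ := coeff_eq_zero hD b b'
  have r₅ : e₃ * e₂ + 2 * κ ^ 2 = 0 := by
    linear_combination (1 + κ ^ 2) * r₂ + (κ * e₃ * e₂ - 2 * κ) * hκ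
  have r₆ : e₁ * e₂ - 2 * κ ^ 2 = 0 := by
    linear_combination (1 - 2 * κ ^ 2) * (e₂ * r₁ - (1 + κ * e₁) * r₅)
      + (4 * κ * (e₁ * e₂) - 4 * κ + 2 * e₁ * (1 - 2 * κ ^ 2)) * hκ
  have r₇ : κ * e₁ * e₂ = 0 := by linear_combination κ * r₆ + 2 * hκ
  -- `e₃` and `e₄` enter the amplitudes only with a factor `κ`, so they are needed modulo `κ²` only.
  have r₈ : κ * e₃ = κ * (-e₁ + κ * e₁ ^ 2) := by
    linear_combination κ * (1 - κ * e₁) * r₁ + (e₃ * e₁ ^ 2 - 2 * e₁ * (1 - κ * e₁)) * hκ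
  have r₉ : κ * e₄ = κ * (-e₂ + κ * e₂ ^ 2) := by
    linear_combination κ * (1 - κ * e₂) * r₄ + (e₄ * e₂ ^ 2 - 2 * e₄ * (1 - κ * e₂)) * hκ
  rw [hz₃, hw₃] at n₃
  rw [hz₄, hw₄] at n₄
  refine ⟨r₆, ?_, ?_⟩
  · linear_combination n₃ - (1 + κ * e₁) ^ 2 * n₁ - (1 - κ ^ 2) ^ 2 * e₂ ^ 2 * n₂ - N * r₈
      - (1 - κ ^ 2) * (z₁ * w₂ + w₁ * z₂) * r₇
      + (N * e₁ ^ 3 - κ * e₂ ^ 2 * N * (1 - κ * e₂)) * hκ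
  · linear_combination n₄ - (1 + κ * e₂ + 2 * κ ^ 2) ^ 2 * n₂ - (1 + κ ^ 2) ^ 2 * e₁ ^ 2 * n₁
      - N * r₉ - (z₁ * w₂ + w₁ * z₂) * r₇
      + (-N * (-e₂ ^ 3 - 4 * e₂ + (4 * e₂ + 4 * κ) * (1 - κ * e₂))
        - e₁ * (z₁ * w₂ + w₁ * z₂) * (e₂ + 2 * κ) - κ * e₁ ^ 2 * N * (1 - κ * e₁)) * hκ

/-! ### Elimination of the outer sites -/

/-- The sum of `f` over the four lattice sites coupled to `j`. -/
def neighbourSum {Q : Type*} [Add Q] (f : ℤ → Q) (j : ℤ) : Q :=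
  f (j + 1) + f (j - 1) + f (j + 3) + f (j - 3)

/-- Elimination of the outer sites: the equations at the four central sites modulo `κ³`. The terms in
`κ²` come from the paths of length three between central sites through two outer sites; there are
two of them for each of the bonds `1–2`, `2–3`, `3–4` and none for `4–1`. -/
theorem reduced_equations {Q : Type*} [CommRing Q] {κ : Q} {e f : ℤ → Q}
    (hoff : ∀ k ∉ Finset.Icc (1 : ℤ) 4, κ ^ 2 * f k = 0)
    (hrec : ∀ k ∉ Finset.Icc (1 : ℤ) 4, f k + κ * neighbourSum f k = 0)
    (hon : ∀ j ∈ Finset.Icc (1 : ℤ) 4, neighbourSum f j + (e j + κ) * f j = 0) :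
    e 1 * f 1 - κ * (f 1 + f 3) + (f 2 + f 4) + 2 * κ ^ 2 * f 2 = 0 ∧
    e 2 * f 2 - κ * (f 2 + f 4) + (1 + 2 * κ ^ 2) * (f 1 + f 3) = 0 ∧
    e 3 * f 3 - κ * (f 1 + f 3) + (1 + 2 * κ ^ 2) * (f 2 + f 4) = 0 ∧
    e 4 * f 4 - κ * (f 2 + f 4) + (f 1 + f 3) + 2 * κ ^ 2 * f 3 = 0 := by
  have z (k : ℤ) (hk : k ∉ Finset.Icc (1 : ℤ) 4 := by decide) := hoff k hk
  have r (k : ℤ) (hk : k ∉ Finset.Icc (1 : ℤ) 4 := by decide) := hrec k hk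
  have s₁ := hon 1 (by decide)
  have s₂ := hon 2 (by decide)
  have s₃ := hon 3 (by decide)
  have s₄ := hon 4 (by decide)
  have r₀ := r 0
  have r₁ := r (-1)
  have r₂ := r (-2)
  have r₃ := r (-3)
  have r₄ := r (-5)
  have r₅ := r 5
  have r₆ := r 6
  have r₇ := r 7
  -- `e₃` and `e₄` enter the amplitudes only with a factor `κ`, so they are needed modulo `κ²` only.
  have r₈ := r 8
  have r₉ := r 9
  have r₁₀ := r 10
  norm_num [neighbourSum] at s₁ s₂ s₃ s₄ r₀ r₁ r₂ r₃ r₄ r₅ r₆ r₇ r₈ r₉ r₁₀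
  -- Multiplied by `κ`, the value at an outer site is `-κ²` times the sum of its central neighbours.
  have t₁ : κ * f (-1) = -κ ^ 2 * f 2 := by
    linear_combination κ * r₁ - z 0 - z (-2) - z (-4)
  have t₃ : κ * f (-3) = 0 := by linear_combination κ * r₃ - z (-2) - z (-4) - z 0 - z (-6)
  have t₄ : κ * f (-5) = 0 := by linear_combination κ * r₄ - z (-4) - z (-6) - z (-2) - z (-8)
  have t₆ : κ * f 6 = -κ ^ 2 * f 3 := by linear_combination κ * r₆ - z 7 - z 5 - z 9
  have t₈ : κ * f 8 = 0 := by linear_combination κ * r₈ - z 9 - z 7 - z 11 - z 5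
  have t₁₀ : κ * f 10 = 0 := by linear_combination κ * r₁₀ - z 11 - z 9 - z 13 - z 7
  have t₀ : κ * f 0 = -κ ^ 2 * (f 1 + f 3) := by
    linear_combination κ * r₀ - z (-1) - z (-3)
  have t₂ : κ * f (-2) = -κ ^ 2 * f 1 := by
    linear_combination κ * r₂ - z (-1) - z (-3) - z (-5)
  have t₅ : κ * f 5 = -κ ^ 2 * (f 2 + f 4) := by linear_combination κ * r₅ - z 6 - z 8
  have t₇ : κ * f 7 = -κ ^ 2 * f 4 := by linear_combination κ * r₇ - z 6 - z 8 - z 10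
  have t₄' : κ * f (-4) = 0 := by
    have := r (-4)
    norm_num [neighbourSum] at this
    linear_combination κ * this - z (-3) - z (-5) - z (-1) - z (-7)
  have t₉ : κ * f 9 = 0 := by
    linear_combination κ * r₉ - z 10 - z 8 - z 12 - z 6
  refine ⟨?_, ?_, ?_, ?_⟩
  · linear_combination s₁ - r₀ - r₂ + 2 * t₁ + 2 * t₃ + t₄
  · linear_combination s₂ - r₁ - r₅ + t₀ + t₂ + t₄' + t₆ + t₈
  · linear_combination s₃ - r₀ - r₆ + t₁ + t₃ + t₅ + t₇ + t₉
  · linear_combination s₄ - r₅ - r₇ + 2 * t₆ + 2 * t₈ + t₁₀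

/-- The two consequences of the reduced equations from which the contradiction is drawn, with
`N`, `e`, `f` and the conjugate `g` of `f` in a ring where divisibility by `κ ^ 3` stands for
`O(κ³)`. The factors `e 1` and `e 2` on the right hand side of the second one are kept because the
detunings may be as small as `κ`. -/
theorem detuning_relations {B : Type*} [CommRing B] {κ N : B} {e f g : ℤ → B}
    (hf : ∀ k ∉ Finset.Icc (1 : ℤ) 4, κ ∣ f k) (hg : ∀ k ∉ Finset.Icc (1 : ℤ) 4, κ ∣ g k)
    (rf : ∀ k ∉ Finset.Icc (1 : ℤ) 4, κ ^ 3 ∣ f k + κ * neighbourSum f k)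
    (rg : ∀ k ∉ Finset.Icc (1 : ℤ) 4, κ ^ 3 ∣ g k + κ * neighbourSum g k)
    (sf : ∀ j ∈ Finset.Icc (1 : ℤ) 4, neighbourSum f j + (e j + κ) * f j = 0)
    (sg : ∀ j ∈ Finset.Icc (1 : ℤ) 4, neighbourSum g j + (e j + κ) * g j = 0)
    (hn : ∀ j ∈ Finset.Icc (1 : ℤ) 4, κ ^ 3 ∣ f j * g j - (N - κ * N * e j))
    (hD : IsUnit (f 1 * g 2 - g 1 * f 2)) :
    ∃ t p q r : B, e 1 * e 2 = 2 * κ ^ 2 + κ ^ 3 * t ∧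
      2 * κ ^ 2 * N * (e 1 + e 2) = κ ^ 3 * (e 1 * p + e 2 * q) + κ ^ 4 * r := by
  -- Divisibility by `κ ^ 3` becomes equality in the quotient ring, where the relations are derived.
  set π := Ideal.Quotient.mk (Ideal.span {κ ^ 3}) with hπ
  have key (x : B) : π x = 0 ↔ κ ^ 3 ∣ x := by
    rw [hπ, Ideal.Quotient.eq_zero_iff_mem, Ideal.mem_span_singleton]
  have π₂ : π 2 = 2 := map_ofNat π 2
  have π₃ : π 3 = 3 := map_ofNat π 3
  have π₄ : π 4 = 4 := map_ofNat π 4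
  have hκ : π κ ^ 3 = 0 := by rw [← map_pow]; exact (key _).2 dvd_rfl
  have hred (u : ℤ → B) (hu : ∀ k ∉ Finset.Icc (1 : ℤ) 4, κ ∣ u k)
      (ru : ∀ k ∉ Finset.Icc (1 : ℤ) 4, κ ^ 3 ∣ u k + κ * neighbourSum u k)
      (su : ∀ j ∈ Finset.Icc (1 : ℤ) 4, neighbourSum u j + (e j + κ) * u j = 0) :=
    reduced_equations (κ := π κ) (e := fun j => π (e j)) (f := fun j => π (u j))
      (fun k hk => by
        rw [← map_pow, ← map_mul, key]
        obtain ⟨v, hv⟩ := hu k hk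
        exact ⟨v, by rw [hv]; ring⟩)
      (fun k hk => by simpa [neighbourSum] using (key _).2 (ru k hk))
      (fun j hj => by simpa [neighbourSum] using congrArg π (su j hj))
  obtain ⟨h₁, h₂, h₃, h₄⟩ := hred f hf rf sf
  obtain ⟨k₁, k₂, k₃, k₄⟩ := hred g hg rg sg
  have hn' (j : ℤ) (hj : j ∈ Finset.Icc (1 : ℤ) 4) :
      π (f j) * π (g j) = π N - π κ * π N * π (e j) := by
    simpa [sub_eq_zero] using (key _).2 (hn j hj)
  have hD' : IsUnit (π (f 1) * π (g 2) - π (g 1) * π (f 2)) := by simpa using hD.map π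
  obtain ⟨a, b, c⟩ := truncated_relations hκ hD' h₁ h₂ h₃ h₄ k₁ k₂ k₃ k₄ (hn' 1 (by decide))
    (hn' 2 (by decide)) (hn' 3 (by decide)) (hn' 4 (by decide))
  obtain ⟨t, ht⟩ := (key (e 1 * e 2 - 2 * κ ^ 2)).1 (by simpa [π₂] using a)
  obtain ⟨u, hu⟩ := (key ((1 - κ ^ 2) * e 2 * (f 1 * g 2 + g 1 * f 2)
    + (1 - 2 * κ ^ 2) * e 2 ^ 2 * N * (1 - κ * e 2))).1 (by simpa [π₂] using b)
  obtain ⟨v, hv⟩ := (key (4 * κ ^ 2 * N + (1 + 3 * κ ^ 2) * e 1 * (f 1 * g 2 + g 1 * f 2)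
    + (1 + 2 * κ ^ 2) * e 1 ^ 2 * N * (1 - κ * e 1))).1 (by simpa [π₂, π₃, π₄] using c)
  -- The second identity is `e 2` times the relation from site 4 minus `e 1` times the one from
  -- site 3, with `e 1 * e 2` replaced by its value.
  refine ⟨t, -u - t * N + (2 + κ * t) * N * (1 + 2 * κ ^ 2) * e 1 - 2 * κ * (2 + κ * t) * N,
    v + t * N - (2 + κ * t) * N * (1 - 2 * κ ^ 2) * e 2 - 2 * κ * (2 + κ * t) * N,
    -4 * (2 + κ * t) * (f 1 * g 2 + g 1 * f 2), by linear_combination ht, ?_⟩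
  linear_combination e 2 * hv - e 1 * hu + (N * (e 2 - e 1) - 4 * κ ^ 2 * (f 1 * g 2 + g 1 * f 2)
    - 2 * κ ^ 2 * N * (e 1 + e 2)
    - κ * N * ((1 - 2 * κ ^ 2) * e 2 ^ 2 - (1 + 2 * κ ^ 2) * e 1 ^ 2)) * ht

/-! ### The sign obstruction -/

/-- The detuning relations force `N` to be of the order of `κ`, as `e₁` and `e₂` have the same sign
and hence `2 |κ| ≤ |e₁| + |e₂| = |e₁ + e₂|`. -/
theorem le_mul_abs_of_detuning_relations {e₁ e₂ κ N C : ℝ} {t p q r : ℂ} (hκ : κ ≠ 0)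
    (hN : 0 < N)
    (ht : ‖t‖ ≤ C) (hp : ‖p‖ ≤ C) (hq : ‖q‖ ≤ C) (hr : ‖r‖ ≤ C) (hC : C * |κ| ≤ 1)
    (h₁ : (e₁ : ℂ) * e₂ = 2 * κ ^ 2 + κ ^ 3 * t)
    (h₂ : 2 * (κ : ℂ) ^ 2 * N * (e₁ + e₂) = κ ^ 3 * (e₁ * p + e₂ * q) + κ ^ 4 * r) :
    N ≤ C * |κ| := by
  have hk : 0 < |κ| := abs_pos.2 hκ
  have hsq : κ ^ 2 = |κ| ^ 2 := (sq_abs κ).symm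
  have hC0 : 0 ≤ C := (norm_nonneg _).trans ht
  have b₁ : |e₁ * e₂ - 2 * κ ^ 2| ≤ |κ| ^ 2 := by
    have : ((e₁ * e₂ - 2 * κ ^ 2 : ℝ) : ℂ) = κ ^ 3 * t := by push_cast; linear_combination h₁
    rw [← Real.norm_eq_abs, ← Complex.norm_real, this, norm_mul, norm_pow, Complex.norm_real,
      Real.norm_eq_abs]
    calc |κ| ^ 3 * ‖t‖ ≤ |κ| ^ 3 * C := by gcongr
      _ = |κ| ^ 2 * (C * |κ|) := by ring
      _ ≤ |κ| ^ 2 * 1 := by gcongr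
      _ = _ := mul_one _
  have hpos : |κ| ^ 2 ≤ e₁ * e₂ := by
    have := (abs_le.1 b₁).1
    rw [hsq] at this
    linarith
  have hS : |e₁ + e₂| = |e₁| + |e₂| := by
    have h0 : 0 < e₁ * e₂ := lt_of_lt_of_le (by positivity) hpos
    rcases mul_pos_iff.1 h0 with ⟨h, h'⟩ | ⟨h, h'⟩
    · rw [abs_of_pos h, abs_of_pos h', abs_of_pos (add_pos h h')]
    · rw [abs_of_neg h, abs_of_neg h', abs_of_neg (add_neg h h')]; ring
  set S := |e₁| + |e₂| with hSdef
  have hS2 : 2 * |κ| ≤ S := by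
    apply abs_le_of_sq_le_sq' _ (by positivity) |>.2
    have : S ^ 2 = (e₁ + e₂) ^ 2 := by rw [← hS, sq_abs]
    rw [this]
    nlinarith [sq_nonneg (e₁ - e₂)]
  have b₂ : 2 * |κ| ^ 2 * N * S ≤ |κ| ^ 3 * (C * S) + |κ| ^ 4 * C := by
    have e : ‖2 * (κ : ℂ) ^ 2 * N * (e₁ + e₂)‖ = 2 * |κ| ^ 2 * N * S := by
      rw [← hS, norm_mul, norm_mul, norm_mul, norm_pow, ← Complex.ofReal_add,
        Complex.norm_real (e₁ + e₂)]
      simp [abs_of_pos hN]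
    rw [← e, h₂]
    refine (norm_add_le _ _).trans ?_
    rw [norm_mul, norm_mul, norm_pow, norm_pow, Complex.norm_real, Real.norm_eq_abs]
    have : ‖(e₁ : ℂ) * p + e₂ * q‖ ≤ C * S := by
      refine (norm_add_le _ _).trans ?_
      rw [norm_mul, norm_mul, Complex.norm_real, Complex.norm_real, Real.norm_eq_abs,
        Real.norm_eq_abs, hSdef, mul_add, mul_comm C, mul_comm C]
      gcongr
    gcongr
  have hSp : 0 < S := by linarith
  have : 2 * |κ| ^ 2 * S * N ≤ 2 * |κ| ^ 2 * S * (C * |κ|) := by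
    have h4 : |κ| ^ 4 * C ≤ |κ| ^ 3 * (C * S) := by
      have : |κ| ^ 3 * C * |κ| ≤ |κ| ^ 3 * C * S := by gcongr; linarith
      linarith
    nlinarith [b₂, h4]
  exact le_of_mul_le_mul_left this (by positivity)

/-! ### Solutions along a sequence of parameters -/

/-- The stationary equation with all multiples of `φ j` collected on the left. -/
theorem IsStationarySolution.balance {ω ε : ℝ} {φ : EllTwo} (h : IsStationarySolution ω ε φ)
    (j : ℤ) :
    ((ω - 2 * ε - 3 / 4 * ‖φ j‖ ^ 2 : ℝ) : ℂ) * φ j = -((ε : ℂ) / 2) * neighbourSum φ j := by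
  have := h j
  simp only [latticeLaplacian] at this
  simp only [neighbourSum]
  push_cast at this ⊢
  linear_combination this

theorem norm_neighbourSum_le {f : ℤ → ℂ} {M : ℝ} (h : ∀ j, ‖f j‖ ≤ M) (j : ℤ) :
    ‖neighbourSum f j‖ ≤ 4 * M := by
  have := norm_add_le (f (j + 1) + f (j - 1) + f (j + 3)) (f (j - 3))
  have := norm_add_le (f (j + 1) + f (j - 1)) (f (j + 3))
  have := norm_add_le (f (j + 1)) (f (j - 1))
  unfold neighbourSum
  linarith [h (j + 1), h (j - 1), h (j + 3), h (j - 3)]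

/-- The ring `ℕ →ᵇ ℂ` of bounded complex sequences, as bounded functions on discrete `ℕ`. -/
abbrev BddSeq : Type := BoundedContinuousFunction ℕ ℂ

/-- A complex sequence with an explicit bound, as an element of the ring of bounded sequences. -/
noncomputable def toBddSeq (u : ℕ → ℂ) (C : ℝ) (h : ∀ n, ‖u n‖ ≤ C) : BddSeq :=
  BoundedContinuousFunction.ofNormedAddCommGroupDiscrete u C h

@[simp] theorem toBddSeq_apply (u : ℕ → ℂ) (C : ℝ) (h : ∀ n, ‖u n‖ ≤ C) (n : ℕ) :
    toBddSeq u C h n = u n := rfl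

theorem neighbourSum_apply (f : ℤ → BddSeq) (j : ℤ) (n : ℕ) :
    neighbourSum f j n = neighbourSum (fun k => f k n) j := rfl

/-- There is no sequence of solutions with `ε → 0` that is bounded, bounded below on the central
sites, small on the outer sites, and for which the values at the sites `1` and `2` stay uniformly
away from being real multiples of each other. -/
theorem no_stationary_sequence_of_independent {R ω c : ℝ} (hR : 0 < R) (hω : 0 < ω)
    (hc : 0 < c) {ε : ℕ → ℝ} {F : ℕ → ℤ → ℂ} (hε₀ : ∀ n, ε n ≠ 0) (hε : Tendsto ε atTop (𝓝 0))
    (hεω : ∀ n, |ε n| ≤ ω / 8)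
    (hsol : ∀ n j, ((ω - 2 * ε n - 3 / 4 * ‖F n j‖ ^ 2 : ℝ) : ℂ) * F n j
      = -((ε n : ℂ) / 2) * neighbourSum (F n) j)
    (hF : ∀ n j, ‖F n j‖ ≤ 2 * R)
    (hlow : ∀ n, ∀ j ∈ Finset.Icc (1 : ℤ) 4, R / 2 ≤ ‖F n j‖)
    (hsmall : ∀ n, ∀ j ∉ Finset.Icc (1 : ℤ) 4, 3 / 4 * ‖F n j‖ ^ 2 ≤ ω / 4)
    (hD : ∀ n, c ≤ ‖F n 1 * star (F n 2) - star (F n 1) * F n 2‖) : False := by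
  have hε1 (n) := (abs_le.1 (hεω n)).1
  have hε2 (n) := (abs_le.1 (hεω n)).2
  set ρ : ℕ → ℝ := fun n => ω - 2 * ε n with hρ
  have hρ1 (n) : ω / 2 ≤ ρ n := by simp only [hρ]; linarith [hε2 n]
  have hρ2 (n) : ρ n ≤ 2 * ω := by simp only [hρ]; linarith [hε1 n]
  have hρ0 (n) : 0 < ρ n := by linarith [hρ1 n]
  set κ : ℕ → ℝ := fun n => ε n / (2 * ρ n) with hκ
  have hεκ (n) : ε n = 2 * ρ n * κ n := by
    have := (hρ0 n).ne'
    simp only [hκ]; field_simp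
  have hκ0 (n) : κ n ≠ 0 := div_ne_zero (hε₀ n) (by have := hρ0 n; positivity)
  have hκε (n) : |κ n| ≤ |ε n| / ω := by
    simp only [hκ, abs_div]
    rw [abs_of_pos (by have := hρ0 n; positivity : 0 < 2 * ρ n)]
    exact div_le_div_of_nonneg_left (abs_nonneg _) hω (by linarith [hρ1 n])
  have hκ1 (n) : |κ n| ≤ 1 := (hκε n).trans (by rw [div_le_one hω]; linarith [hεω n])
  have hεκ' (n) : |ε n| ≤ 4 * ω * |κ n| := by
    rw [hεκ, abs_mul, abs_of_pos (by have := hρ0 n; positivity : 0 < 2 * ρ n)]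
    exact mul_le_mul_of_nonneg_right (by linarith [hρ2 n]) (abs_nonneg _)
  set m : ℕ → ℤ → ℝ := fun n j => 2 / ε n * (ρ n - 3 / 4 * ‖F n j‖ ^ 2) with hm
  have hon (n j) : neighbourSum (F n) j + m n j * F n j = 0 := by
    have h := hsol n j
    have h0 : (ε n : ℂ) ≠ 0 := by exact_mod_cast hε₀ n
    have : ((2 / ε n : ℝ) : ℂ) * (ε n / 2) = 1 := by push_cast; field_simp
    simp only [hm, hρ]
    push_cast at h this ⊢
    linear_combination (2 / (ε n : ℂ)) * h - neighbourSum (F n) j * this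
  have hm16 (n) (j) (hj : j ∈ Finset.Icc (1 : ℤ) 4) : |m n j| ≤ 16 := by
    have h1 : |m n j| * ‖F n j‖ ≤ 8 * R := by
      rw [← Real.norm_eq_abs, ← Complex.norm_real, ← norm_mul,
        eq_neg_of_add_eq_zero_right (hon n j), norm_neg]
      linarith [norm_neighbourSum_le (hF n) j]
    have h2 := mul_le_mul_of_nonneg_left (hlow n j hj) (abs_nonneg (m n j))
    by_contra! h
    nlinarith
  have hoff (n) (j) (hj : j ∉ Finset.Icc (1 : ℤ) 4) : ‖F n j‖ ≤ 64 * R * |κ n| := by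
    have h1 := congrArg norm (hsol n j)
    rw [norm_mul, norm_mul, norm_neg, norm_div, Complex.norm_real, Complex.norm_real,
      Real.norm_eq_abs, Real.norm_eq_abs, Complex.norm_ofNat] at h1
    have h2 : ω / 4 ≤ |ω - 2 * ε n - 3 / 4 * ‖F n j‖ ^ 2| :=
      le_trans (by linarith [hρ1 n, hsmall n j hj]) (le_abs_self _)
    have h3 : ω / 4 * ‖F n j‖ ≤ |ε n| / 2 * (4 * (2 * R)) :=
      (mul_le_mul_of_nonneg_right h2 (norm_nonneg _)).trans (h1.trans_le
        (mul_le_mul_of_nonneg_left (norm_neighbourSum_le (hF n) j) (by positivity)))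
    have h4 : |ε n| / 2 * (4 * (2 * R)) ≤ ω / 4 * (64 * R * |κ n|) := by
      nlinarith [mul_le_mul_of_nonneg_right (hεκ' n) hR.le]
    exact le_of_mul_le_mul_left (h3.trans h4) (by positivity)
  have hg (n) (j) (hj : j ∉ Finset.Icc (1 : ℤ) 4) : ‖F n j / κ n‖ ≤ 64 * R := by
    rw [norm_div, Complex.norm_real, Real.norm_eq_abs, div_le_iff₀ (abs_pos.2 (hκ0 n))]
    exact hoff n j hj
  let K : BddSeq := toBddSeq (fun n => κ n) 1 fun n => by
    rw [Complex.norm_real]; exact hκ1 n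
  let P : BddSeq := toBddSeq (fun n => ρ n) (2 * ω) fun n => by
    rw [Complex.norm_real, Real.norm_of_nonneg (hρ0 n).le]; exact hρ2 n
  let f : ℤ → BddSeq := fun j => toBddSeq (fun n => F n j) (2 * R) fun n => hF n j
  let e : ℤ → BddSeq := fun j =>
    if hj : j ∈ Finset.Icc (1 : ℤ) 4 then
      toBddSeq (fun n => ((m n j - κ n : ℝ) : ℂ)) 17 fun n => by
        rw [Complex.norm_real]
        exact (norm_sub_le _ _).trans (by
          rw [Real.norm_eq_abs, Real.norm_eq_abs]; linarith [hm16 n j hj, hκ1 n])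
    else 0
  have he (j) (hj : j ∈ Finset.Icc (1 : ℤ) 4) (n) : e j n = ((m n j - κ n : ℝ) : ℂ) := by
    simp only [e, dif_pos hj, toBddSeq_apply]
  -- The common amplitude `N = (4/3) (ω - 2ε - εκ/2)`, where `ε/2 = ρκ`.
  let A : BddSeq := (4 / 3 : ℂ) • (P - P * K ^ 2)
  have hKs : star K = K := by ext n; simp [K]
  have hes (j) (hj : j ∈ Finset.Icc (1 : ℤ) 4) : star (e j) = e j := by
    ext n; simp [he j hj n]
  -- The values at the outer sites are `O(κ)`.
  have hf : ∀ k ∉ Finset.Icc (1 : ℤ) 4, K ∣ f k := fun k hk =>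
    ⟨toBddSeq (fun n => F n k / κ n) (64 * R) fun n => hg n k hk, by
      ext n
      have : (κ n : ℂ) ≠ 0 := by exact_mod_cast hκ0 n
      simp [f, K]; field_simp⟩
  -- The cubic term at the outer sites is `O(κ³)`.
  have rf : ∀ k ∉ Finset.Icc (1 : ℤ) 4, K ^ 3 ∣ f k + K * neighbourSum f k := fun k hk => by
    refine ⟨toBddSeq (fun n => ((3 / (4 * ρ n) * ‖F n k / κ n‖ ^ 2 : ℝ) : ℂ) * (F n k / κ n))
      (3 / (2 * ω) * (64 * R) ^ 2 * (64 * R)) fun n => ?_, ?_⟩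
    · rw [norm_mul, Complex.norm_real, Real.norm_of_nonneg (by have := hρ0 n; positivity)]
      have h1 := hg n k hk
      have h2 : 3 / (4 * ρ n) ≤ 3 / (2 * ω) :=
        div_le_div_of_nonneg_left (by norm_num) (by positivity) (by linarith [hρ1 n])
      gcongr
    · ext n
      have h0 : (κ n : ℂ) ≠ 0 := by exact_mod_cast hκ0 n
      have h1 : (ρ n : ℂ) ≠ 0 := by exact_mod_cast (hρ0 n).ne'
      have h := hsol n k
      have hn : ((‖F n k / κ n‖ : ℝ) : ℂ) ^ 2 = (‖F n k‖ : ℂ) ^ 2 / (κ n : ℂ) ^ 2 := by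
        rw [norm_div, Complex.norm_real, Real.norm_eq_abs]
        push_cast
        rw [div_pow, ← Complex.ofReal_pow |κ n|, sq_abs]
        push_cast; rfl
      have hk' : (ε n : ℂ) = 2 * ρ n * κ n := by exact_mod_cast hεκ n
      have hr : (ρ n : ℂ) = ω - 2 * ε n := by simp [hρ]
      simp only [BoundedContinuousFunction.coe_add, BoundedContinuousFunction.coe_mul,
        BoundedContinuousFunction.coe_pow, Pi.add_apply, Pi.mul_apply, Pi.pow_apply,
        neighbourSum_apply, f, K, toBddSeq_apply]
      push_cast at h ⊢
      rw [hn]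
      rw [← hr] at h
      have h2 : (ρ n : ℂ) * (F n k + κ n * neighbourSum (F n) k)
          = 3 / 4 * (‖F n k‖ : ℂ) ^ 2 * F n k := by
        linear_combination h - neighbourSum (F n) k / 2 * hk'
      apply mul_left_cancel₀ h1
      refine h2.trans ?_
      field_simp
  have sf : ∀ j ∈ Finset.Icc (1 : ℤ) 4, neighbourSum f j + (e j + K) * f j = 0 := fun j hj => by
    ext n
    simp only [BoundedContinuousFunction.coe_add, BoundedContinuousFunction.coe_mul,
      Pi.add_apply, Pi.mul_apply, neighbourSum_apply, he j hj, f, K, toBddSeq_apply,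
      BoundedContinuousFunction.coe_zero, Pi.zero_apply]
    push_cast
    linear_combination hon n j
  have hstar (j) : star (neighbourSum f j) = neighbourSum (fun k => star (f k)) j := by
    simp [neighbourSum]
  -- Exactly `‖f j‖² = A - β e_j` with `β = (4/3)ρκ`, which differs from `κA = (4/3)ρ(κ - κ³)`
  -- by a multiple of `κ³`.
  have hn : ∀ j ∈ Finset.Icc (1 : ℤ) 4, K ^ 3 ∣ f j * star (f j) - (A - K * A * e j) := by
    intro j hj
    refine ⟨-((4 / 3 : ℂ) • (P * e j)), ?_⟩
    ext n
    have h1 : F n j * star (F n j) = ((‖F n j‖ ^ 2 : ℝ) : ℂ) := by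
      rw [Complex.star_def, Complex.mul_conj, Complex.normSq_eq_norm_sq]
    have h2 : ‖F n j‖ ^ 2 = 4 / 3 * (ρ n - ρ n * κ n * m n j) := by
      have : ε n * m n j = 2 * (ρ n - 3 / 4 * ‖F n j‖ ^ 2) := by
        have := hε₀ n
        simp only [hm]; field_simp
      rw [hεκ n] at this
      linarith
    simp only [BoundedContinuousFunction.coe_sub, BoundedContinuousFunction.coe_mul,
      BoundedContinuousFunction.coe_pow, Pi.sub_apply, Pi.mul_apply, Pi.pow_apply,
      BoundedContinuousFunction.coe_neg, Pi.neg_apply, BoundedContinuousFunction.star_apply,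
      BoundedContinuousFunction.coe_smul, smul_eq_mul, he j hj, A, P, f, K, toBddSeq_apply]
    rw [h1, h2]
    push_cast
    ring
  have hunit : IsUnit (f 1 * star (f 2) - star (f 1) * f 2) := by
    refine IsUnit.of_mul_eq_one (toBddSeq
      (fun n => (F n 1 * star (F n 2) - star (F n 1) * F n 2)⁻¹) c⁻¹ fun n => ?_) ?_
    · rw [norm_inv]
      exact inv_anti₀ hc (hD n)
    · ext n
      exact mul_inv_cancel₀ (norm_pos_iff.1 (hc.trans_le (hD n)))
  obtain ⟨t, p, q, r, h₁, h₂⟩ := detuning_relations (N := A) (e := e) (g := fun k => star (f k)) hf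
    (fun k hk => by simpa [starRingEnd_apply, hKs] using map_dvd (starRingEnd BddSeq) (hf k hk)) rf
    (fun k hk => by
      have := map_dvd (starRingEnd BddSeq) (rf k hk)
      rwa [starRingEnd_apply, starRingEnd_apply, star_add, star_mul', hstar, star_pow, hKs] at this)
    sf
    (fun j hj => by
      have := congrArg star (sf j hj)
      rwa [star_add, star_mul', hstar, star_add, hKs, hes j hj, star_zero] at this)
    hn hunit
  set C := max (max ‖t‖ ‖p‖) (max ‖q‖ ‖r‖) with hC
  have hlim : Tendsto (fun n => C * |κ n|) atTop (𝓝 0) := by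
    have : Tendsto (fun n => |ε n| / ω) atTop (𝓝 0) := by
      simpa using hε.abs.div_const ω
    simpa using (squeeze_zero (fun n => abs_nonneg _) hκε this).const_mul C
  obtain ⟨n, hn1, hn2⟩ := ((hlim.eventually_lt_const (by positivity : (0 : ℝ) < ω / 2)).and
    (hlim.eventually_lt_const zero_lt_one)).exists
  have hκ8 : κ n ^ 2 ≤ 1 / 16 := by
    have : |κ n| ≤ 1 / 4 := (hκε n).trans (by rw [div_le_iff₀ hω]; linarith [hεω n])
    rw [← sq_abs]
    nlinarith [abs_nonneg (κ n)]
  have hA : ω / 2 ≤ 4 / 3 * (ρ n - ρ n * κ n ^ 2) := by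
    nlinarith [hρ1 n, mul_le_mul_of_nonneg_left hκ8 (hρ0 n).le]
  have h₁' := congrArg (fun u : BddSeq => u n) h₁
  have h₂' := congrArg (fun u : BddSeq => u n) h₂
  have := le_mul_abs_of_detuning_relations (e₁ := m n 1 - κ n) (e₂ := m n 2 - κ n)
    (N := 4 / 3 * (ρ n - ρ n * κ n ^ 2)) (t := t n) (p := p n) (q := q n) (r := r n) (C := C)
    (hκ0 n) (by linarith)
    ((t.norm_coe_le_norm n).trans (by simp [hC])) ((p.norm_coe_le_norm n).trans (by simp [hC]))
    ((q.norm_coe_le_norm n).trans (by simp [hC])) ((r.norm_coe_le_norm n).trans (by simp [hC]))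
    hn2.le
    (by
      have e₁ := he 1 (by decide) n
      have e₂ := he 2 (by decide) n
      rw [← e₁, ← e₂]
      exact h₁')
    (by
      have e₁ := he 1 (by decide) n
      have e₂ := he 2 (by decide) n
      have : ((4 / 3 * (ρ n - ρ n * κ n ^ 2) : ℝ) : ℂ) = A n := by simp [A, P, K]
      rw [← e₁, ← e₂, this]
      exact h₂')
  linarith

/-! ### Continuations of the four-site configuration -/

/-- Conservation of the density current at the site `j`. -/
theorem IsStationarySolution.im_star_mul_neighbourSum {ω ε : ℝ} {φ : EllTwo} (hε : ε ≠ 0)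
    (h : IsStationarySolution ω ε φ) (j : ℤ) : (star (φ j) * neighbourSum φ j).im = 0 := by
  have h1 := h.balance j
  have h2 : ((ε / 2 : ℝ) : ℂ) * (star (φ j) * neighbourSum φ j)
      = ((-(ω - 2 * ε - 3 / 4 * ‖φ j‖ ^ 2) * ‖φ j‖ ^ 2 : ℝ) : ℂ) := by
    have h3 : star (φ j) * φ j = ((‖φ j‖ ^ 2 : ℝ) : ℂ) := by
      rw [Complex.star_def, mul_comm, Complex.mul_conj, Complex.normSq_eq_norm_sq]
    push_cast at h1 h3 ⊢
    linear_combination star (φ j) * h1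
      - (ω - 2 * ε - 3 / 4 * (‖φ j‖ : ℂ) ^ 2) * h3
  have h4 := congrArg Complex.im h2
  rw [Complex.im_ofReal_mul, Complex.ofReal_im] at h4
  exact (mul_eq_zero.1 h4).resolve_left (by positivity)

theorem fourSiteConfig_of_mem {R : ℝ} {θ : ℤ → ℝ} {j : ℤ} (hj : j ∈ Finset.Icc (1 : ℤ) 4) :
    fourSiteConfig R θ j = (R : ℂ) * Complex.exp (Complex.I * (θ j : ℂ)) := if_pos hj

theorem fourSiteConfig_of_notMem {R : ℝ} {θ : ℤ → ℝ} {j : ℤ} (hj : j ∉ Finset.Icc (1 : ℤ) 4) :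
    fourSiteConfig R θ j = 0 := if_neg hj

theorem norm_fourSiteConfig {R : ℝ} (hR : 0 < R) {θ : ℤ → ℝ} {j : ℤ}
    (hj : j ∈ Finset.Icc (1 : ℤ) 4) : ‖fourSiteConfig R θ j‖ = R := by
  rw [fourSiteConfig_of_mem hj, norm_mul, Complex.norm_real, mul_comm Complex.I,
    Complex.norm_exp_ofReal_mul_I, mul_one, Real.norm_of_nonneg hR.le]

theorem im_star_mul_fourSiteConfig {R : ℝ} {θ : ℤ → ℝ} {j k : ℤ}
    (hj : j ∈ Finset.Icc (1 : ℤ) 4) (hk : k ∈ Finset.Icc (1 : ℤ) 4) :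
    (star (fourSiteConfig R θ j) * fourSiteConfig R θ k).im = R ^ 2 * Real.sin (θ k - θ j) := by
  rw [fourSiteConfig_of_mem hj, fourSiteConfig_of_mem hk, mul_comm Complex.I, mul_comm Complex.I,
    Complex.exp_mul_I, Complex.exp_mul_I]
  simp only [← Complex.ofReal_cos, ← Complex.ofReal_sin, Complex.star_def, Real.sin_sub]
  simp
  simp only [Complex.cos_ofReal_re, Complex.sin_ofReal_re]
  ring

/-- The equation at `ε = 0` fixes the frequency. -/
theorem IsContinuation.omega_eq {R ω : ℝ} (hR : 0 < R) {θ : ℤ → ℝ} {E : Set ℝ} {φ : ℝ → EllTwo}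
    (h : IsContinuation ω (fourSiteConfig R θ) E φ) : ω = 3 / 4 * R ^ 2 := by
  have h1 := (h.solves 0 h.zero_mem).balance 1
  rw [h.start, norm_fourSiteConfig hR (by decide)] at h1
  have h2 : fourSiteConfig R θ 1 ≠ 0 := by
    rw [← norm_pos_iff, norm_fourSiteConfig hR (by decide)]; exact hR
  have h3 : ((ω - 2 * 0 - 3 / 4 * R ^ 2 : ℝ) : ℂ) = 0 := by simpa [h2] using h1
  have := Complex.ofReal_eq_zero.1 h3
  linarith

/-- The limit of the current conservation law at the two inner sites. -/
theorem IsContinuation.sin_phase_eq {R ω : ℝ} (hR : 0 < R) {θ : ℤ → ℝ} {E : Set ℝ}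
    {φ : ℝ → EllTwo} (h : IsContinuation ω (fourSiteConfig R θ) E φ)
    {ε : ℕ → ℝ} (hE : ∀ n, ε n ∈ E) (h0 : ∀ n, ε n ≠ 0)
    (hlim : ∀ j, Tendsto (fun n => φ (ε n) j) atTop (𝓝 (fourSiteConfig R θ j))) :
    Real.sin (θ 2 - θ 1) = Real.sin (θ 3 - θ 2) ∧
      Real.sin (θ 3 - θ 2) = Real.sin (θ 4 - θ 3) := by
  have key (j : ℤ) :
      (star (fourSiteConfig R θ j) * neighbourSum (fourSiteConfig R θ) j).im = 0 := by
    refine tendsto_nhds_unique (f := fun n : ℕ =>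
      (star (φ (ε n) j) * neighbourSum (φ (ε n)) j).im) (l := atTop) ?_ ?_
    · refine (Complex.continuous_im.tendsto _).comp ?_
      exact (hlim j).star.mul ((((hlim _).add (hlim _)).add (hlim _)).add (hlim _))
    · simp only [(h.solves _ (hE _)).im_star_mul_neighbourSum (h0 _)]
      exact tendsto_const_nhds
  have hR2 : R ^ 2 ≠ 0 := by positivity
  have k₂ := key 2
  have k₃ := key 3
  norm_num only [neighbourSum] at k₂ k₃
  rw [fourSiteConfig_of_notMem (j := 5) (by decide),
    fourSiteConfig_of_notMem (j := -1) (by decide), add_zero, add_zero, mul_add, Complex.add_im,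
    im_star_mul_fourSiteConfig (by decide) (by decide),
    im_star_mul_fourSiteConfig (by decide) (by decide), ← mul_add] at k₂
  rw [fourSiteConfig_of_notMem (j := 6) (by decide),
    fourSiteConfig_of_notMem (j := 0) (by decide), add_zero, add_zero, mul_add, Complex.add_im,
    im_star_mul_fourSiteConfig (by decide) (by decide),
    im_star_mul_fourSiteConfig (by decide) (by decide), ← mul_add] at k₃
  have s₂ := (mul_eq_zero.1 k₂).resolve_left hR2
  have s₃ := (mul_eq_zero.1 k₃).resolve_left hR2
  rw [← neg_sub (θ 2) (θ 1), Real.sin_neg] at s₂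
  rw [← neg_sub (θ 3) (θ 2), Real.sin_neg] at s₃
  constructor <;> linarith

theorem theoremt (R ω : ℝ) (hR : 0 < R) (θ : ℤ → ℝ)
    (hcont : CanBeContinued ω (fourSiteConfig R θ)) :
    ∀ j ∈ Finset.Icc (1 : ℤ) 3,
      phaseShift θ j = 0 ∨ phaseShift θ j = (Real.pi : Real.Angle) := by
  obtain ⟨E, φ, h⟩ := hcont
  have hωR := h.omega_eq hR
  have hω : 0 < ω := by rw [hωR]; positivity
  choose ε hεE hε0 hεlt using fun n : ℕ =>
    h.accumulates (1 / ((n : ℝ) + 1)) (by positivity)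
  have hε : Tendsto ε atTop (𝓝 0) :=
    squeeze_zero_norm (fun n => (hεlt n).le) tendsto_one_div_add_atTop_nhds_zero_nat
  have hφ : Tendsto (fun n => φ (ε n)) atTop (𝓝 (φ 0)) :=
    h.continuous_at_zero.tendsto.comp
      (tendsto_nhdsWithin_iff.2 ⟨hε, Eventually.of_forall hεE⟩)
  have hdist (n : ℕ) (j : ℤ) : ‖φ (ε n) j - fourSiteConfig R θ j‖ ≤ ‖φ (ε n) - φ 0‖ := by
    rw [← h.start j]
    exact lp.norm_apply_le_norm (by norm_num) (φ (ε n) - φ 0) j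
  have hnorm : Tendsto (fun n => ‖φ (ε n) - φ 0‖) atTop (𝓝 0) :=
    tendsto_iff_norm_sub_tendsto_zero.1 hφ
  have hlim (j : ℤ) : Tendsto (fun n => φ (ε n) j) atTop (𝓝 (fourSiteConfig R θ j)) :=
    tendsto_iff_norm_sub_tendsto_zero.2
      (squeeze_zero (fun _ => norm_nonneg _) (fun n => hdist n j) hnorm)
  obtain ⟨s₁, s₂⟩ := h.sin_phase_eq hR hεE hε0 hlim
  -- If the common sine were nonzero, then `z₁` and `z₂` would stay independent over `ℝ`.
  have hsin : Real.sin (θ 2 - θ 1) = 0 := by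
    by_contra hs
    set D : (ℤ → ℂ) → ℂ := fun u => u 1 * star (u 2) - star (u 1) * u 2 with hDdef
    have hD0 : 0 < ‖D (fourSiteConfig R θ)‖ := by
      rw [norm_pos_iff]
      intro h0
      have h1 : (star (fourSiteConfig R θ 1) * fourSiteConfig R θ 2).im = 0 := by
        have := congrArg Complex.im h0
        simp [hDdef] at this ⊢
        linarith
      rw [im_star_mul_fourSiteConfig (by decide) (by decide)] at h1
      exact hs ((mul_eq_zero.1 h1).resolve_left (by positivity))
    have hDlim : Tendsto (fun n => ‖D (φ (ε n))‖) atTop (𝓝 ‖D (fourSiteConfig R θ)‖) :=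
      (((hlim 1).mul (hlim 2).star).sub ((hlim 1).star.mul (hlim 2))).norm
    obtain ⟨n₀, hn₀⟩ := eventually_atTop.1 (((hDlim.eventually_const_le (half_lt_self hD0)).and
      (hnorm.eventually_le_const (half_pos hR))).and
      ((by simpa using hε.abs : Tendsto (fun n => |ε n|) atTop (𝓝 0)).eventually_le_const
        (by positivity : 0 < ω / 8)))
    have hd (n : ℕ) (j : ℤ) : ‖φ (ε (n + n₀)) j - fourSiteConfig R θ j‖ ≤ R / 2 :=
      (hdist _ j).trans (hn₀ (n + n₀) (by omega)).1.2
    refine no_stationary_sequence_of_independent (R := R) (ω := ω) (ε := fun n => ε (n + n₀))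
      (F := fun n => φ (ε (n + n₀))) hR hω (half_pos hD0) (fun n => hε0 _)
      ((tendsto_add_atTop_iff_nat n₀).2 hε) (fun n => (hn₀ (n + n₀) (by omega)).2)
      (fun n j => (h.solves _ (hεE _)).balance j) (fun n j => ?_) (fun n j hj => ?_)
      (fun n j hj => ?_) (fun n => (hn₀ (n + n₀) (by omega)).1.1)
    · have h1 := norm_le_norm_add_norm_sub' (φ (ε (n + n₀)) j) (fourSiteConfig R θ j)
      have h2 : ‖fourSiteConfig R θ j‖ ≤ R := by
        by_cases hj : j ∈ Finset.Icc (1 : ℤ) 4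
        · exact (norm_fourSiteConfig hR hj).le
        · rw [fourSiteConfig_of_notMem hj, norm_zero]; exact hR.le
      linarith [hd n j]
    · have h1 := norm_le_norm_add_norm_sub (φ (ε (n + n₀)) j) (fourSiteConfig R θ j)
      rw [norm_fourSiteConfig hR hj] at h1
      linarith [hd n j]
    · have h1 := hd n j
      rw [fourSiteConfig_of_notMem hj, sub_zero] at h1
      have h2 : ‖φ (ε (n + n₀)) j‖ ^ 2 ≤ (R / 2) ^ 2 := by gcongr
      rw [hωR]
      linarith
  intro j hj
  rw [← Real.Angle.sin_eq_zero_iff, phaseShift, Real.Angle.sin_coe]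
  obtain ⟨h1, h3⟩ := Finset.mem_Icc.1 hj
  have : j = 1 ∨ j = 2 ∨ j = 3 := by omega
  rcases this with rfl | rfl | rfl <;> norm_num only
  · exact hsin
  · rw [← s₁, hsin]
  · rw [← s₂, ← s₁, hsin]
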